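/- Let $G=(V,E)$ be a finite nonempty simple graph and let $s,s'\in\mathbb N\cup\{\infty\}$. In the cop and fast robber game on $G$, the cop chooses an initial vertex, then the robber chooses one; afterwards they move alternately with full information, the cop first. At his turn the cop stays or moves to a neighbour; the robber, at his turn, moves along a path (possibly of length $0$) of length at most $s$ that does not contain the vertex occupied by the cop. The cop wins if after finitely many moves he is at the same vertex as the robber. Write $G\in\mathcal{CWFR}(s)$ if the cop has a winning strategy, where a strategy may depend on all previous moves. Let $N_r(x)$ be the set of vertices joined to $x$ by a path of length at most $r$, and $N_r(x,G\setminus\{y\})$ the set of vertices joined to $x$ by such a path avoiding $y$. The graph $G$ is $(s,s')$-dismantlable if its vertices can be ordered $v_1,\dots,v_m$ so that for each $i<m$ there is $j>i$ with $N_s(v_i,G\setminus\{v_j\})\cap\{v_i,\dots,v_m\}\subseteq N_{s'}(v_j)$. A block of $G$ is a maximal connected subgraph without a cut vertex (so it is $2$-connected, a single edge, or an isolated vertex of $G$); two distinct blocks share at most one vertex. A vertex $u$ of a block $B$ dominates $B$ if it is adjacent to all other vertices of $B$. Call two distinct blocks adjacent if they share a vertex. If a block $R$ is chosen as root, a block $P$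 is the father of a block $B$ if $P$ and $B$ are adjacent and $B$ is one step farther from $R$ than $P$ in the resulting graph on the blocks. The graph $G$ is a big brother graph if this graph on the blocks is connected and a root $R$ can be chosen so that every block is dominated by one of its vertices and every block $B\ne R$ is dominated by the vertex that it shares with its father. Theorem. The following conditions are equivalent: (i) $G\in\mathcal{CWFR}(3)$; (i$'$) $G$ is $(3,1)$-dismantlable; (ii) $G\in\mathcal{CWFR}(\infty)$; (ii$'$) $G$ is $(\infty,1)$-dismantlable; (iii) $G$ is a big brother graph. In particular, for all $s,t\in\mathbb N\cup\{\infty\}$ with $s,t\ge 3$ one has $G\in\mathcal{CWFR}(s)$ if and only if $G\in\mathcal{CWFR}(t)$. -/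

import Mathlib

namespace FastRobber

variable {V : Type*}

/-- The ball `N_r(x)`: all vertices joined to `x` by a walk of length at most `r`. For `r = ∞`
this is the connected component of `x`. -/
def ball (G : SimpleGraph V) (r : ℕ∞) (x : V) : Set V :=
  {v | ∃ p : G.Walk x v, (p.length : ℕ∞) ≤ r}

/-- The punctured ball `N_r(x, G \ {y})`: all vertices joined to `x` by a walk of length at most
`r` that avoids `y`. -/
def puncturedBall (G : SimpleGraph V) (r : ℕ∞) (x y : V) : Set V :=
  {v | ∃ p : G.Walk x v, (p.length : ℕ∞) ≤ r ∧ y ∉ p.support}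

/-! ### The cop and fast robber game -/

/-- A strategy of a cop of speed `s'`. The history is the list of the pairs (cop position, robber
position) of the rounds played so far, latest round first; `next []` is the initial position of
the cop, and each later move goes along a walk of length at most `s'`. -/
structure CopStrategy (G : SimpleGraph V) (s' : ℕ∞) where
  next : List (V × V) → V
  legal : ∀ (c r : V) (h : List (V × V)), next ((c, r) :: h) ∈ ball G s' c

/-- The history of the first `n` rounds when the cop follows `σ` and the robber is at `r i` at the
end of round `i`. In each round the cop moves first. -/
def CopStrategy.history {G : SimpleGraph V} {s' : ℕ∞} (σ : CopStrategy G s') (r : ℕ → V) :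
    ℕ → List (V × V)
  | 0 => []
  | n + 1 => (σ.next (σ.history r n), r n) :: σ.history r n

/-- The position of the cop in round `n` (round `0` is the choice of the initial positions). -/
def CopStrategy.cop {G : SimpleGraph V} {s' : ℕ∞} (σ : CopStrategy G s') (r : ℕ → V) (n : ℕ) : V :=
  σ.next (σ.history r n)

/-- The robber, standing at `r n` at the end of round `n`, is captured by then or by the next move
of the cop. -/
def CopStrategy.Captured {G : SimpleGraph V} {s' : ℕ∞} (σ : CopStrategy G s') (r : ℕ → V)
    (n : ℕ) : Prop :=
  σ.cop r n = r n ∨ σ.cop r (n + 1) = r n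

/-- As long as he has not been captured, the robber moves along walks of length at most `s` that
avoid the current position of the cop. -/
def CopStrategy.LegalRobber {G : SimpleGraph V} {s' : ℕ∞} (σ : CopStrategy G s') (s : ℕ∞)
    (r : ℕ → V) : Prop :=
  ∀ n, (∀ m ≤ n, ¬ σ.Captured r m) → r (n + 1) ∈ puncturedBall G s (r n) (σ.cop r (n + 1))

/-- `G` belongs to the class `CWFR(s, s')`: a single cop of speed `s'` has a strategy that captures
a robber of speed `s` after finitely many moves, whatever the robber does. -/
def CWFR' (G : SimpleGraph V) (s s' : ℕ∞) : Prop :=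
  ∃ σ : CopStrategy G s', ∀ r : ℕ → V, σ.LegalRobber s r → ∃ n, σ.Captured r n

/-- `G` belongs to the class `CWFR(s) = CWFR(s, 1)`. -/
def CWFR (G : SimpleGraph V) (s : ℕ∞) : Prop := CWFR' G s 1

/-! ### Dismantlability -/

/-- `G` is `(s, s')`-dismantlable: its vertices can be ordered `v 0, …, v (m - 1)` so that for each
`i` but the last there is `j > i` with `N_s(v i, G \ {v j}) ∩ X_i ⊆ N_{s'}(v j)`, where
`X_i = {v i, …, v (m - 1)}`. -/
def Dismantlable (G : SimpleGraph V) (s s' : ℕ∞) : Prop :=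
  ∃ (m : ℕ) (v : Fin m ≃ V), ∀ i : Fin m, (i : ℕ) + 1 < m →
    ∃ j : Fin m, i < j ∧
      puncturedBall G s (v i) (v j) ∩ v '' Set.Ici i ⊆ ball G s' (v j)

/-! ### Blocks and big brother graphs -/

/-- The subgraph of `G` induced by `B` is connected and has no cut vertex. A single vertex and a
single edge qualify. -/
def Nonseparable (G : SimpleGraph V) (B : Set V) : Prop :=
  (G.induce B).Connected ∧ ∀ v ∈ B, (G.induce (B \ {v})).Preconnected

/-- A block of `G`, given by its vertex set (blocks are induced subgraphs). It is 2-connected, or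
a single edge, or an isolated vertex of `G`. -/
def IsBlock (G : SimpleGraph V) (B : Set V) : Prop := Maximal (Nonseparable G) B

/-- The type of blocks of `G`. -/
abbrev Block (G : SimpleGraph V) := {B : Set V // IsBlock G B}

/-- Two distinct blocks are adjacent when they share a vertex. -/
def blockGraph (G : SimpleGraph V) : SimpleGraph (Block G) where
  Adj B C := B ≠ C ∧ (B.1 ∩ C.1).Nonempty
  symm := ⟨fun _ _ h => ⟨h.1.symm, by rw [Set.inter_comm]; exact h.2⟩⟩
  loopless := ⟨fun _ h => h.1 rfl⟩

/-- In the block-decomposition rooted at `R`, built level by level from `R` by joining each labelled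
block to the not yet labelled blocks that meet it, `P` is the father of `B`. -/
def IsFather (G : SimpleGraph V) (R P B : Block G) : Prop :=
  (blockGraph G).Adj P B ∧ (blockGraph G).dist R B = (blockGraph G).dist R P + 1

/-- The vertex `u` of `B` is adjacent to all other vertices of `B`. -/
def Dominates (G : SimpleGraph V) (u : V) (B : Set V) : Prop :=
  u ∈ B ∧ ∀ v ∈ B, v ≠ u → G.Adj u v

/-- `G` is a big brother graph: its blocks form a tree rooted at some block `R` (so that every block
is reached from `R`), each block is dominated by one of its vertices, and each block `B ≠ R` is
dominated by the articulation point that it shares with its father. -/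
def IsBigBrother (G : SimpleGraph V) : Prop :=
  (blockGraph G).Connected ∧ (∀ B : Block G, ∃ u, Dominates G u B.1) ∧
    ∃ R : Block G, ∀ P B : Block G, IsFather G R P B →
      ∃ a, P.1 ∩ B.1 = {a} ∧ Dominates G a B.1

end FastRobber

/-!
Call `x` a corner of `X` if some other `y ∈ X` satisfies `N_s(x, G \ {y}) ∩ X ⊆ N_{s'}(y)`. If a
corner is deleted, the cop can chase the shadow of the robber in `X \ {x}`, which is `y` when the
robber is at `x`. Conversely, once corners have been deleted until none is left, `G` retracts onto
the remaining set `X`, and if `X` has two vertices then the robber survives by staying in `X`, away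
from the retract of the cop. Hence `CWFR(s, s')` is `(s, s')`-dismantlability.

For `s ≥ 3` and `s' = 1`, adding the vertices back one by one maintains a rooted spanning tree whose
parent function `d` satisfies: every edge of `G` joins a vertex to its parent or two siblings. Such
a tree makes every leaf of maximal depth a corner, even for `s = ∞`. A block consists of siblings
and perhaps their parent, so that its top vertex dominates it; in the opposite direction, the
parent of `v` is the dominating vertex of the block that contains `v` and is closest to the root
block.
-/

namespace FastRobber

variable {V : Type*} {G : SimpleGraph V} {s s' t : ℕ∞} {X : Set V} {x y z : V}

/-! ### Balls -/

theorem mem_ball_self : x ∈ ball G s x :=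
  ⟨.nil, by simp⟩

theorem mem_ball_comm : y ∈ ball G s x ↔ x ∈ ball G s y :=
  ⟨fun ⟨p, hp⟩ => ⟨p.reverse, by simpa using hp⟩, fun ⟨p, hp⟩ => ⟨p.reverse, by simpa using hp⟩⟩

theorem mem_ball_one : y ∈ ball G 1 x ↔ y = x ∨ G.Adj x y := by
  constructor
  · rintro ⟨p, hp⟩
    rcases (G.edist_le_one_iff_adj_or_eq).1 (p.edist_le.trans hp) with h | h
    exacts [.inr h, .inl h.symm]
  · rintro (rfl | h)
    exacts [mem_ball_self, ⟨h.toWalk, by simp⟩]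

theorem mem_puncturedBall_self (h : x ≠ y) : x ∈ puncturedBall G s x y :=
  ⟨.nil, by simp, by simpa using h.symm⟩

theorem mem_puncturedBall_comm : z ∈ puncturedBall G s x y ↔ x ∈ puncturedBall G s z y :=
  ⟨fun ⟨p, hp, hy⟩ => ⟨p.reverse, by simpa using hp, by simpa using hy⟩,
    fun ⟨p, hp, hy⟩ => ⟨p.reverse, by simpa using hp, by simpa using hy⟩⟩

theorem puncturedBall_mono (h : s ≤ t) : puncturedBall G s x y ⊆ puncturedBall G t x y :=
  fun _ ⟨p, hp, hy⟩ => ⟨p, hp.trans h, hy⟩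

@[simp]
theorem puncturedBall_self : puncturedBall G s x x = ∅ :=
  Set.eq_empty_of_forall_notMem fun _ ⟨p, _, hx⟩ => hx p.start_mem_support

theorem mem_puncturedBall_step {w : V} (hz : z ∈ puncturedBall G s x y) (hzw : G.Adj z w)
    (hw : w ≠ y) : w ∈ puncturedBall G (s + 1) x y := by
  obtain ⟨p, hp, hy⟩ := hz
  refine ⟨p.concat hzw, ?_, by simp [SimpleGraph.Walk.support_concat, hy, hw.symm]⟩
  rw [SimpleGraph.Walk.length_concat, Nat.cast_add, Nat.cast_one]
  gcongr

theorem puncturedBall_avoid_or (w : V) (h : z ∈ puncturedBall G s x y) :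
    z ∈ puncturedBall G s x w ∨ z ∈ puncturedBall G s w y := by
  classical
  obtain ⟨p, hp, hy⟩ := h
  by_cases hw : w ∈ p.support
  · refine .inr ⟨p.dropUntil w hw, le_trans ?_ hp,
      fun h => hy (p.support_dropUntil_subset_support hw h)⟩
    exact_mod_cast p.length_dropUntil_le_length hw
  · exact .inl ⟨p, hp, hw⟩

theorem ball_avoid_or (hs : s' ≤ s) (w : V) (h : y ∈ ball G s' x) :
    y ∈ puncturedBall G s x w ∨ y ∈ ball G s' w ∧ x ∈ ball G s' w := by
  classical
  obtain ⟨p, hp⟩ := h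
  by_cases hw : w ∈ p.support
  · refine .inr ⟨⟨p.dropUntil w hw, le_trans ?_ hp⟩,
      mem_ball_comm.1 ⟨p.takeUntil w hw, le_trans ?_ hp⟩⟩
    · exact_mod_cast p.length_dropUntil_le_length hw
    · exact_mod_cast p.length_takeUntil_le_length hw
  · exact .inl ⟨p, hp.trans hs, hw⟩

/-! ### Corners and dismantling -/

/-- The vertex `x` of `X` is dominated by another vertex `y` of `X`, which allows `x` to be deleted
next when the vertices of `G` outside `X` have already been deleted. -/
structure IsCorner (G : SimpleGraph V) (s s' : ℕ∞) (X : Set V) (x y : V) : Prop where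
  left_mem : x ∈ X
  right_mem : y ∈ X
  ne : x ≠ y
  subset : puncturedBall G s x y ∩ X ⊆ ball G s' y

theorem IsCorner.mem_ball_of_mem_ball (h : IsCorner G s s' X x y) (hs : s' ≤ s) (hz : z ∈ X)
    (hzx : z ∈ ball G s' x) : z ∈ ball G s' y :=
  (ball_avoid_or hs y hzx).elim (fun hzy => h.subset ⟨hzy, hz⟩) And.left

/-- `X` can be reduced to a single vertex by successively deleting corners. Unlike in
`Dismantlable`, the set `X` may be smaller than the vertex set of `G`, and walks may leave it. -/
inductive DismantlableSet (G : SimpleGraph V) (s s' : ℕ∞) : Set V → Prop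
  | singleton (x : V) : DismantlableSet G s s' {x}
  | delete {X : Set V} {x y : V} (h : IsCorner G s s' X x y)
      (hX : DismantlableSet G s s' (X \ {x})) : DismantlableSet G s s' X

theorem DismantlableSet.exists_order (h : DismantlableSet G s s' X) :
    ∃ (m : ℕ) (v : Fin m → V), Function.Injective v ∧ Set.range v = X ∧
      ∀ i : Fin m, (i : ℕ) + 1 < m → ∃ j, i < j ∧
        puncturedBall G s (v i) (v j) ∩ v '' Set.Ici i ⊆ ball G s' (v j) := by
  induction h with
  | singleton x =>
    exact ⟨1, fun _ => x, Function.injective_of_subsingleton _, by simp, fun i hi => by omega⟩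
  | @delete X x y h _ ih =>
    obtain ⟨m, v, hinj, hrange, hv⟩ := ih
    have hrange_cons : Set.range (Fin.cons x v : Fin (m + 1) → V) = X := by
      rw [Fin.range_cons, hrange, Set.insert_sdiff_singleton, Set.insert_eq_of_mem h.left_mem]
    refine ⟨m + 1, Fin.cons x v, ?_, hrange_cons, Fin.cases (fun _ => ?_) fun i hi => ?_⟩
    · exact Fin.cons_injective_iff.2 ⟨by simp [hrange], hinj⟩
    · obtain ⟨j, rfl⟩ : y ∈ Set.range v := hrange ▸ ⟨h.right_mem, h.ne.symm⟩
      exact ⟨j.succ, Fin.succ_pos j, fun z ⟨hz, hzX⟩ =>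
        h.subset ⟨hz, hrange_cons ▸ Set.image_subset_range _ _ hzX⟩⟩
    · obtain ⟨j, hij, hj⟩ := hv i (by simpa using hi)
      refine ⟨j.succ, Fin.succ_lt_succ_iff.2 hij, ?_⟩
      rintro _ ⟨hz, k, hk, rfl⟩
      obtain ⟨k, rfl⟩ := Fin.exists_succ_eq.2 ((Fin.succ_pos i).trans_le hk).ne'
      exact hj ⟨hz, k, Fin.succ_le_succ_iff.1 hk, rfl⟩

theorem dismantlable_iff [Nonempty V] :
    Dismantlable G s s' ↔ DismantlableSet G s s' Set.univ := by
  constructor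
  · rintro ⟨m, v, hv⟩
    obtain ⟨n, rfl⟩ := Nat.exists_eq_succ_of_ne_zero (Fin.pos (v.symm (Classical.arbitrary V))).ne'
    suffices ∀ i, DismantlableSet G s s' (v '' Set.Ici i) by
      simpa [Set.range_eq_univ.2 v.surjective] using this 0
    intro i
    induction i using Fin.reverseInduction with
    | last => simpa [← Fin.top_eq_last] using DismantlableSet.singleton _
    | cast i ih =>
      obtain ⟨j, hij, hj⟩ := hv i.castSucc (by simp)
      refine .delete ⟨⟨_, Set.self_mem_Ici, rfl⟩, ⟨j, hij.le, rfl⟩, v.injective.ne hij.ne, hj⟩ ?_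
      have hIci : Set.Ici i.castSucc \ {i.castSucc} = Set.Ici i.succ := by
        rw [Set.Ici_sdiff_left]
        ext k
        exact Fin.castSucc_lt_iff_succ_le
      rwa [← Set.image_singleton, ← Set.image_sdiff v.injective, hIci]
  · intro h
    obtain ⟨m, v, hinj, hrange, hv⟩ := h.exists_order
    exact ⟨m, .ofBijective v ⟨hinj, Set.range_eq_univ.1 hrange⟩, hv⟩

/-! ### The cop wins on a dismantlable graph -/

/-- The cop, who is at `c` and about to move, gets within one move of a robber, who is at `r` and
always ends his moves in `X`, in at most `n` rounds. -/
def CopWins (G : SimpleGraph V) (s s' : ℕ∞) (X : Set V) : ℕ → V → V → Prop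
  | 0, c, r => r ∈ ball G s' c
  | n + 1, c, r => ∃ c' ∈ ball G s' c, ∀ r' ∈ puncturedBall G s r c' ∩ X, CopWins G s s' X n c' r'

theorem CopWins.of_mem_ball {c r : V} (h : r ∈ ball G s' c) : ∀ n, CopWins G s s' X n c r
  | 0 => h
  | _ + 1 => ⟨r, h, by simp⟩

open Classical in
theorem IsCorner.shadow_move (h : IsCorner G s s' X x y) (hs : s' ≤ s) {c r r' : V} (hr : r ∈ X)
    (hr' : r' ∈ X) (hrr' : r' ∈ puncturedBall G s r c) :
    (if r' = x then y else r') ∈ puncturedBall G s (if r = x then y else r) c ∨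
      (if r' = x then y else r') ∈ ball G s' c := by
  have from_corner {z : V} (hz : z ∈ X) (hzx : z ∈ puncturedBall G s x c) :
      z ∈ puncturedBall G s y c ∨ z ∈ ball G s' c ∧ y ∈ ball G s' c :=
    (puncturedBall_avoid_or y hzx).elim
      (fun hzy => ball_avoid_or hs c (h.subset ⟨hzy, hz⟩)) Or.inl
  split_ifs with hrx hr'x hr'x
  · by_cases hc : y = c
    exacts [.inr (hc ▸ mem_ball_self), .inl (mem_puncturedBall_self hc)]
  · subst hrx
    exact (from_corner hr' hrr').imp_right And.left
  · subst hr'x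
    exact (from_corner hr (mem_puncturedBall_comm.1 hrr')).imp mem_puncturedBall_comm.1 And.right
  · exact .inl hrr'

open Classical in
theorem CopWins.of_shadow (h : IsCorner G s s' X x y) (hs : s' ≤ s) {n : ℕ} {c r : V} (hr : r ∈ X)
    (hw : CopWins G s s' (X \ {x}) n c (if r = x then y else r)) :
    CopWins G s s' X (n + 1) c r := by
  induction n generalizing c r with
  | zero =>
    refine ⟨_, hw, ?_⟩
    split_ifs with hrx
    · exact hrx ▸ h.subset
    · simp
  | succ n ih =>
    obtain ⟨c', hc', hw⟩ := hw
    refine ⟨c', hc', fun r' ⟨hrr', hr'⟩ => ih hr' ?_⟩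
    rcases h.shadow_move hs hr hr' hrr' with hmove | hcapture
    · refine hw _ ⟨hmove, ?_⟩
      split_ifs with hr'x
      exacts [⟨h.right_mem, h.ne.symm⟩, ⟨hr', hr'x⟩]
    · exact .of_mem_ball hcapture n

theorem DismantlableSet.exists_copWins (h : DismantlableSet G s s' X) (hs : s' ≤ s) :
    ∃ n c, ∀ r ∈ X, CopWins G s s' X n c r := by
  classical
  induction h with
  | singleton x => exact ⟨0, x, by rintro _ rfl; exact mem_ball_self⟩
  | delete h _ ih =>
    obtain ⟨n, c, hc⟩ := ih
    refine ⟨n + 1, c, fun r hr => .of_shadow h hs hr (hc _ ?_)⟩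
    split_ifs with hrx
    exacts [⟨h.right_mem, h.ne.symm⟩, ⟨hr, hrx⟩]

theorem CopStrategy.length_history (σ : CopStrategy G s') (r : ℕ → V) (n : ℕ) :
    (σ.history r n).length = n := by
  induction n with
  | zero => rfl
  | succ n ih => rw [CopStrategy.history, List.length_cons, ih]

theorem exists_copWins_move (G : SimpleGraph V) (s s' : ℕ∞) (n : ℕ) (c r : V) :
    ∃ c' ∈ ball G s' c, (CopWins G s s' Set.univ n c r → c' = r ∨ 0 < n ∧
      ∀ r' ∈ puncturedBall G s r c', CopWins G s s' Set.univ (n - 1) c' r') := by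
  by_cases h : CopWins G s s' Set.univ n c r
  · cases n with
    | zero => exact ⟨r, h, fun _ => .inl rfl⟩
    | succ n =>
      obtain ⟨c', hc', hw⟩ := h
      exact ⟨c', hc', fun _ => .inr ⟨n.succ_pos, fun r' hr' => hw r' ⟨hr', trivial⟩⟩⟩
  · exact ⟨c, mem_ball_self, fun hw => absurd hw h⟩

theorem cwfr'_of_copWins {N : ℕ} {c : V} (h : ∀ r, CopWins G s s' Set.univ N c r) :
    CWFR' G s s' := by
  choose move hmove hwin using exists_copWins_move G s s'
  let next : List (V × V) → V
    | [] => c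
    | (c, r) :: h => move (N - h.length) c r
  let σ : CopStrategy G s' := ⟨next, fun c r h => hmove (N - h.length) c r⟩
  refine ⟨σ, fun r hr => ?_⟩
  by_contra! hfree
  have cop_succ (n : ℕ) : σ.cop r (n + 1) = move (N - n) (σ.cop r n) (r n) := by
    change move (N - (σ.history r n).length) _ _ = _
    rw [σ.length_history]
    rfl
  have wins_lt (n : ℕ) : CopWins G s s' Set.univ (N - n) (σ.cop r n) (r n) ∧ n ≤ N := by
    induction n with
    | zero => exact ⟨h _, N.zero_le⟩
    | succ n ih =>
      rcases hwin _ _ _ ih.1 with hcapture | ⟨hpos, hmove⟩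
      · exact absurd (.inr ((cop_succ n).trans hcapture)) (hfree n)
      · rw [← cop_succ] at hmove
        exact ⟨hmove _ (hr n fun m _ => hfree m), by omega⟩
  exact absurd (wins_lt (N + 1)).2 (by omega)

/-! ### The robber escapes on a graph that is not dismantlable -/

/-- `f` retracts `G` onto the set `X` that is left of `G` after some corners have been deleted; it
maps a vertex to the vertex of `X` that has taken over its role. -/
structure IsRetraction (G : SimpleGraph V) (s s' : ℕ∞) (X : Set V) (f : V → V) : Prop where
  mem : ∀ v, f v ∈ X
  fixed : ∀ v ∈ X, f v = v
  mem_ball : ∀ v w, v ∈ ball G s' w → f v ∈ ball G s' (f w)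
  dominated : ∀ v, puncturedBall G s v (f v) ∩ X ⊆ ball G s' (f v)

theorem isRetraction_id : IsRetraction G s s' Set.univ id where
  mem _ := trivial
  fixed _ _ := rfl
  mem_ball _ _ h := h
  dominated := by simp

open Classical in
theorem IsRetraction.delete {f : V → V} (hf : IsRetraction G s s' X f)
    (h : IsCorner G s s' X x y) (hs : s' ≤ s) :
    IsRetraction G s s' (X \ {x}) fun v => if f v = x then y else f v where
  mem v := by
    split_ifs with hv
    exacts [⟨h.right_mem, h.ne.symm⟩, ⟨hf.mem v, hv⟩]
  fixed v hv := by simp only [hf.fixed v hv.1, if_neg (show v ≠ x from hv.2)]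
  mem_ball v w hvw := by
    have hfvw := hf.mem_ball v w hvw
    split_ifs with hw hv hv
    · exact mem_ball_self
    · rw [hw] at hfvw
      exact h.mem_ball_of_mem_ball hs (hf.mem v) hfvw
    · rw [hv] at hfvw
      exact mem_ball_comm.1 (h.mem_ball_of_mem_ball hs (hf.mem w) (mem_ball_comm.1 hfvw))
    · exact hfvw
  dominated v := by
    split_ifs with hv
    · rintro z ⟨hz, hzX, -⟩
      rcases puncturedBall_avoid_or x hz with hzx | hzy
      · have hzfv := hf.dominated v ⟨hv ▸ hzx, hzX⟩
        exact h.mem_ball_of_mem_ball hs hzX (hv ▸ hzfv)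
      · exact h.subset ⟨hzy, hzX⟩
    · exact fun z ⟨hz, hzX, _⟩ => hf.dominated v ⟨hz, hzX⟩

/-- The play of `σ` against a robber who starts at `start` and answers by `reply r c` when he is at
`r` and the cop has moved to `c`: the history before round `n`, and the position of the robber at
the end of round `n`. -/
def CopStrategy.play (σ : CopStrategy G s') (start : V) (reply : V → V → V) :
    ℕ → List (V × V) × V
  | 0 => ([], start)
  | n + 1 =>
    let (h, r) := σ.play start reply n
    let h' := (σ.next h, r) :: h
    (h', reply r (σ.next h'))

theorem CopStrategy.history_play (σ : CopStrategy G s') (start : V) (reply : V → V → V) (n : ℕ) :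
    σ.history (fun n => (σ.play start reply n).2) n = (σ.play start reply n).1 := by
  induction n with
  | zero => rfl
  | succ n ih => rw [CopStrategy.history, ih]; rfl

theorem CopStrategy.exists_play (σ : CopStrategy G s') (start : V) (reply : V → V → V) :
    ∃ r : ℕ → V, r 0 = start ∧ ∀ n, r (n + 1) = reply (r n) (σ.cop r (n + 1)) := by
  refine ⟨fun n => (σ.play start reply n).2, rfl, fun n => ?_⟩
  rw [CopStrategy.cop, σ.history_play]
  rfl

theorem IsRetraction.exists_reply {f : V → V} (hf : IsRetraction G s s' X f)
    (hX : ∀ x y, ¬ IsCorner G s s' X x y) (hxX : x ∈ X) (c : V) (hxc : x ≠ f c) :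
    ∃ z ∈ X, z ∈ puncturedBall G s x c ∧ z ∉ ball G s' (f c) := by
  obtain ⟨z, ⟨hz, hzX⟩, hzb⟩ := Set.not_subset.1 fun h => hX x (f c) ⟨hxX, hf.mem c, hxc, h⟩
  refine ⟨z, hzX, (puncturedBall_avoid_or c hz).resolve_right fun hzc => ?_, hzb⟩
  exact hzb (hf.dominated c ⟨hzc, hzX⟩)

theorem IsRetraction.not_cwfr' {f : V → V} (hf : IsRetraction G s s' X f) (hX : X.Nontrivial)
    (hcorner : ∀ x y, ¬ IsCorner G s s' X x y) : ¬ CWFR' G s s' := by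
  rintro ⟨σ, hσ⟩
  choose! reply reply_mem reply_legal reply_safe using
    fun (x : V) (hx : x ∈ X) (c : V) (hxc : x ≠ f c) => hf.exists_reply hcorner hx c hxc
  obtain ⟨x₀, hx₀, hx₀c⟩ := hX.exists_ne (f (σ.next []))
  obtain ⟨r, hr0, hr⟩ := σ.exists_play (reply x₀ (σ.next [])) reply
  have ne_of_safe (n : ℕ) (h : r n ∉ ball G s' (f (σ.cop r n))) : r n ≠ f (σ.cop r (n + 1)) :=
    fun he => h (he ▸ hf.mem_ball _ _ (σ.legal _ _ _))
  have safe (n : ℕ) : r n ∈ X ∧ r n ∉ ball G s' (f (σ.cop r n)) := by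
    induction n with
    | zero => exact hr0 ▸ ⟨reply_mem _ hx₀ _ hx₀c, reply_safe _ hx₀ _ hx₀c⟩
    | succ n ih =>
      have hne := ne_of_safe n ih.2
      exact hr n ▸ ⟨reply_mem _ ih.1 _ hne, reply_safe _ ih.1 _ hne⟩
  have legal : σ.LegalRobber s r := fun n _ =>
    hr n ▸ reply_legal _ (safe n).1 _ (ne_of_safe n (safe n).2)
  obtain ⟨n, hn | hn⟩ := hσ r legal
  · exact (safe n).2 (by rw [hn, hf.fixed _ (safe n).1]; exact mem_ball_self)
  · exact ne_of_safe n (safe n).2 (by rw [hn, hf.fixed _ (safe n).1])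

theorem IsRetraction.dismantlableSet [Finite V] {f : V → V} (hf : IsRetraction G s s' X f)
    (hX : X.Nonempty) (hs : s' ≤ s) (hG : CWFR' G s s') : DismantlableSet G s s' X := by
  classical
  induction X using WellFoundedLT.induction generalizing f with
  | ind X ih =>
    rcases hX.exists_eq_singleton_or_nontrivial with ⟨x, rfl⟩ | hX
    · exact .singleton x
    · obtain ⟨x, y, h⟩ : ∃ x y, IsCorner G s s' X x y := by
        by_contra! hcorner
        exact hf.not_cwfr' hX hcorner hG
      exact .delete h (ih _ (Set.sdiff_singleton_ssubset.2 h.left_mem) (hf.delete h hs)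
        ⟨y, h.right_mem, h.ne.symm⟩)

theorem cwfr'_iff_dismantlable [Finite V] [Nonempty V] (hs : s' ≤ s) :
    CWFR' G s s' ↔ Dismantlable G s s' := by
  rw [dismantlable_iff]
  refine ⟨isRetraction_id.dismantlableSet Set.univ_nonempty hs, fun h => ?_⟩
  obtain ⟨n, c, hc⟩ := h.exists_copWins hs
  exact cwfr'_of_copWins fun r => hc r trivial

/-! ### Sibling trees -/

/-- A spanning tree of the subgraph of `G` induced by `X`, given by its parent function, such that
every other edge of the subgraph joins two siblings. The root is its own parent. The rank need not
be the depth; it only witnesses that iterating `parent` leads to the root. -/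
structure SiblingTree (G : SimpleGraph V) (X : Set V) where
  root : V
  parent : V → V
  rank : V → ℕ
  root_mem : root ∈ X
  parent_root : parent root = root
  parent_mem {v : V} : v ∈ X → parent v ∈ X
  adj_parent {v : V} : v ∈ X → v ≠ root → G.Adj v (parent v)
  rank_parent_lt {v : V} : v ∈ X → v ≠ root → rank (parent v) < rank v
  edge {v w : V} : v ∈ X → w ∈ X → G.Adj v w → v = parent w ∨ w = parent v ∨ parent v = parent w

namespace SiblingTree

/-- The tree with a single vertex. -/
def singleton (G : SimpleGraph V) (x : V) : SiblingTree G {x} where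
  root := x
  parent := id
  rank _ := 0
  root_mem := rfl
  parent_root := rfl
  parent_mem := id
  adj_parent hv hvx := absurd hv hvx
  rank_parent_lt hv hvx := absurd hv hvx
  edge := by
    rintro _ _ rfl rfl h
    exact absurd h G.irrefl

theorem rank_parent_le (T : SiblingTree G X) (hx : x ∈ X) : T.rank (T.parent x) ≤ T.rank x := by
  by_cases h : x = T.root
  · rw [h, T.parent_root]
  · exact (T.rank_parent_lt hx h).le

theorem parent_eq_root_of_adj (T : SiblingTree G X) (hx : x ∈ X) (h : G.Adj T.root x) :
    T.parent x = T.root := by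
  rcases T.edge T.root_mem hx h with h' | h' | h'
  · exact h'.symm
  · exact absurd (h'.trans T.parent_root) h.ne'
  · exact h'.symm.trans T.parent_root

open Classical in
/-- The new vertex `x` becomes a child of `y`. -/
noncomputable def insertLeaf (T : SiblingTree G (X \ {x})) (hx : x ∈ X) (hy : y ∈ X)
    (hxy : G.Adj x y) (h : ∀ z ∈ X, G.Adj x z → z = y ∨ T.parent z = y) : SiblingTree G X where
  root := T.root
  parent := Function.update T.parent x y
  rank := Function.update T.rank x (T.rank y + 1)
  root_mem := T.root_mem.1
  parent_root := by rw [Function.update_of_ne T.root_mem.2, T.parent_root]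
  parent_mem {v} hv := by
    rcases eq_or_ne v x with rfl | hvx
    · rwa [Function.update_self]
    · rw [Function.update_of_ne hvx]
      exact (T.parent_mem ⟨hv, hvx⟩).1
  adj_parent {v} hv hvr := by
    rcases eq_or_ne v x with rfl | hvx
    · rwa [Function.update_self]
    · rw [Function.update_of_ne hvx]
      exact T.adj_parent ⟨hv, hvx⟩ hvr
  rank_parent_lt {v} hv hvr := by
    rcases eq_or_ne v x with rfl | hvx
    · simp [Function.update_of_ne hxy.ne']
    · rw [Function.update_of_ne hvx, Function.update_of_ne hvx,
        Function.update_of_ne (T.parent_mem ⟨hv, hvx⟩).2]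
      exact T.rank_parent_lt ⟨hv, hvx⟩ hvr
  edge {v w} hv hw hvw := by
    rcases eq_or_ne v x with rfl | hvx
    · rw [Function.update_self, Function.update_of_ne hvw.ne']
      exact .inr ((h w hw hvw).imp_right Eq.symm)
    rcases eq_or_ne w x with rfl | hwx
    · rw [Function.update_self, Function.update_of_ne hvw.ne]
      exact (h v hv hvw.symm).imp_right .inr
    · rw [Function.update_of_ne hvx, Function.update_of_ne hwx]
      exact T.edge ⟨hv, hvx⟩ ⟨hw, hwx⟩ hvw

open Classical in
/-- The child `y` of the root takes the place of the root, and the old root becomes one of the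
children of `y`. -/
noncomputable def reroot (T : SiblingTree G X) (hy : y ∈ X) (hyr : T.parent y = T.root)
    (h : ∀ v ∈ X, T.parent v = T.root → v ≠ y → G.Adj v y) : SiblingTree G X where
  root := y
  parent v := if T.parent v = T.root then y else T.parent v
  rank v := if v = y then 0 else if T.parent v = T.root then 1 else T.rank v + 2
  root_mem := hy
  parent_root := if_pos hyr
  parent_mem hv := by
    split_ifs
    exacts [hy, T.parent_mem hv]
  adj_parent {v} hv hvy := by
    split_ifs with hvr
    · exact h v hv hvr hvy
    · exact T.adj_parent hv fun he => hvr (he ▸ T.parent_root)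
  rank_parent_lt {v} hv hvy := by
    by_cases hvr : T.parent v = T.root
    · simp [hvr, hvy]
    · have := T.rank_parent_lt hv fun he => hvr (he ▸ T.parent_root)
      simp only [hvr, hvy, if_false]
      split_ifs <;> omega
  edge {v w} hv hw hvw := by
    rcases T.edge hv hw hvw with rfl | rfl | hvw
    · by_cases hwr : T.parent w = T.root
      · simp [hwr, T.parent_root]
      · exact .inl (if_neg hwr).symm
    · by_cases hvr : T.parent v = T.root
      · simp [hvr, T.parent_root]
      · exact .inr (.inl (if_neg hvr).symm)
    · simp [hvw]

theorem parent_eq_root_of_forall_adj (T : SiblingTree G X) (hy : y ∈ X) (hyr : y ≠ T.root)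
    (h : ∀ z ∈ X, G.Adj (T.parent y) z → z ≠ y → G.Adj y z) : T.parent y = T.root := by
  by_contra hpr
  have hp := T.parent_mem hy
  have hg := T.parent_mem hp
  have rank_y := T.rank_parent_lt hy hyr
  have rank_p := T.rank_parent_lt hp hpr
  have rank_g := T.rank_parent_le hg
  have hyg : G.Adj y (T.parent (T.parent y)) := by
    refine h _ hg (T.adj_parent hp hpr) fun he => ?_
    rw [he] at rank_p
    omega
  rcases T.edge hy hg hyg with he | he | he <;> have := congrArg T.rank he <;> omega

theorem exists_root_eq (T : SiblingTree G X) (hy : y ∈ X)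
    (h : ∀ z ∈ X, G.Adj (T.parent y) z → z ≠ y → G.Adj y z) :
    ∃ T' : SiblingTree G X, T'.root = y := by
  by_cases hyr : y = T.root
  · exact ⟨T, hyr.symm⟩
  have hpr := T.parent_eq_root_of_forall_adj hy hyr h
  refine ⟨T.reroot hy hpr fun v hv hvr hvy => ?_, rfl⟩
  by_cases hv_root : v = T.root
  · rw [hv_root, ← hpr]
    exact (T.adj_parent hy hyr).symm
  · refine (h v hv ?_ hvy).symm
    rw [hpr, ← hvr]
    exact (T.adj_parent hv hv_root).symm

end SiblingTree

theorem IsCorner.adj_of_mem_puncturedBall (h : IsCorner G s 1 X x y) (hz : z ∈ X)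
    (hzx : z ∈ puncturedBall G s x y) : G.Adj y z :=
  (mem_ball_one.1 (h.subset ⟨hzx, hz⟩)).resolve_left fun he => by
    rw [he, mem_puncturedBall_comm] at hzx
    simp at hzx

theorem IsCorner.adj (h : IsCorner G s 1 X x y) : G.Adj x y :=
  (h.adj_of_mem_puncturedBall h.left_mem (mem_puncturedBall_self h.ne)).symm

theorem IsCorner.eq_or_adj_of_adj (h : IsCorner G s 1 X x y) (hs : 1 ≤ s) (hz : z ∈ X)
    (hxz : G.Adj x z) : z = y ∨ G.Adj y z :=
  mem_ball_one.1 (h.mem_ball_of_mem_ball hs hz (mem_ball_one.2 (.inr hxz)))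

theorem SiblingTree.parent_mem_puncturedBall (T : SiblingTree G (X \ {x}))
    (h : IsCorner G s 1 X x y) (hs : 1 ≤ s) {p : V} (hp : p ∈ X) (hxp : G.Adj x p) (hpy : p ≠ y)
    (hpp : T.parent p ≠ y) : T.parent y ∈ puncturedBall G 2 x y := by
  have hyX : y ∈ X \ {x} := ⟨h.right_mem, h.ne.symm⟩
  have hpX : p ∈ X \ {x} := ⟨hp, hxp.ne'⟩
  have hp1 : p ∈ puncturedBall G 1 x y := by
    simpa using mem_puncturedBall_step (s := 0) (mem_puncturedBall_self h.ne) hxp hpy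
  have hyp : G.Adj y p := (h.eq_or_adj_of_adj hs hp hxp).resolve_left hpy
  rcases T.edge hyX hpX hyp with he | rfl | he
  · exact absurd he.symm hpp
  · exact puncturedBall_mono one_le_two hp1
  · by_cases hpr : p = T.root
    · rw [he, hpr, T.parent_root, ← hpr]
      exact puncturedBall_mono one_le_two hp1
    · exact mem_puncturedBall_step hp1 (he ▸ T.adj_parent hpX hpr) (he ▸ hpp)

theorem IsCorner.nonempty_siblingTree (h : IsCorner G s 1 X x y) (hs : 3 ≤ s)
    (T : SiblingTree G (X \ {x})) : Nonempty (SiblingTree G X) := by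
  have hs1 : 1 ≤ s := le_trans (by norm_num) hs
  have hyX : y ∈ X \ {x} := ⟨h.right_mem, h.ne.symm⟩
  by_cases hleaf : ∀ p ∈ X, G.Adj x p → p = y ∨ T.parent p = y
  · exact ⟨T.insertLeaf h.left_mem h.right_mem h.adj hleaf⟩
  push Not at hleaf
  obtain ⟨p, hp, hxp, hpy, hpp⟩ := hleaf
  -- `x` reaches every neighbour of the parent of `y` in three steps, by way of `p`
  have hfar : ∀ z ∈ X \ {x}, G.Adj (T.parent y) z → z ≠ y → G.Adj y z := fun z hz hyz hzy =>
    h.adj_of_mem_puncturedBall hz.1 <| puncturedBall_mono hs <|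
      mem_puncturedBall_step (T.parent_mem_puncturedBall h hs1 hp hxp hpy hpp) hyz hzy
  obtain ⟨T', rfl⟩ := T.exists_root_eq hyX hfar
  refine ⟨T'.insertLeaf h.left_mem h.right_mem h.adj fun z hz hxz => ?_⟩
  exact (h.eq_or_adj_of_adj hs1 hz hxz).imp_right (T'.parent_eq_root_of_adj ⟨hz, hxz.ne'⟩)

theorem DismantlableSet.nonempty_siblingTree (h : DismantlableSet G s 1 X) (hs : 3 ≤ s) :
    Nonempty (SiblingTree G X) := by
  induction h with
  | singleton x => exact ⟨.singleton G x⟩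
  | delete h _ ih => exact ih.elim (h.nonempty_siblingTree hs)

namespace SiblingTree

/-- `v` is `a` or one of the descendants of `a`. -/
def Descends (T : SiblingTree G X) (v a : V) : Prop := ∃ n, T.parent^[n] v = a

variable {T : SiblingTree G Set.univ} {a v w : V}

theorem descends_self : T.Descends v v := ⟨0, rfl⟩

theorem descends_parent : T.Descends v (T.parent v) := ⟨1, rfl⟩

theorem descends_iff : T.Descends v a ↔ v = a ∨ T.Descends (T.parent v) a := by
  constructor
  · rintro ⟨_ | n, hn⟩
    exacts [.inl hn, .inr ⟨n, hn⟩]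
  · rintro (rfl | ⟨n, hn⟩)
    exacts [descends_self, ⟨n + 1, hn⟩]

theorem descends_root (T : SiblingTree G Set.univ) (v : V) : T.Descends v T.root := by
  induction h : T.rank v using Nat.strong_induction_on generalizing v with
  | _ n ih =>
    by_cases hv : v = T.root
    · exact descends_iff.2 (.inl hv)
    · exact descends_iff.2 (.inr (ih _ (h ▸ T.rank_parent_lt trivial hv) _ rfl))

theorem Descends.rank_le (h : T.Descends v a) : T.rank a ≤ T.rank v := by
  obtain ⟨n, rfl⟩ := h
  induction n generalizing v with
  | zero => rfl
  | succ n ih => exact ih.trans (T.rank_parent_le trivial)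

theorem Descends.eq_root (h : T.Descends T.root a) : a = T.root := by
  obtain ⟨n, rfl⟩ := h
  exact Function.iterate_fixed T.parent_root n

theorem Descends.rank_lt (h : T.Descends v a) (hva : v ≠ a) : T.rank a < T.rank v := by
  have hv : v ≠ T.root := by
    rintro rfl
    exact hva h.eq_root.symm
  exact ((descends_iff.1 h).resolve_left hva).rank_le.trans_lt (T.rank_parent_lt trivial hv)

theorem Descends.antisymm (h : T.Descends v a) (h' : T.Descends a v) : v = a := by
  by_contra hva
  exact (h.rank_lt hva).not_ge h'.rank_le

theorem Descends.of_adj (h : T.Descends v a) (hva : v ≠ a) (hvw : G.Adj v w) :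
    T.Descends w a := by
  have h' := (descends_iff.1 h).resolve_left hva
  rcases T.edge trivial trivial hvw with rfl | rfl | he
  · exact descends_iff.2 (.inr h)
  · exact h'
  · exact descends_iff.2 (.inr (he ▸ h'))

theorem Descends.of_walk (h : T.Descends v a) (p : G.Walk v w) (ha : a ∉ p.support) :
    T.Descends w a := by
  induction p with
  | nil => exact h
  | cons hadj q ih =>
    rw [SimpleGraph.Walk.support_cons, List.mem_cons, not_or] at ha
    exact ih (h.of_adj (Ne.symm ha.1) hadj) ha.2

/-- A child of the highest rank among the parents is a corner: a walk that leaves it while avoiding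
its parent meets only descendants of the parent, which by maximality are siblings. -/
theorem isCorner_parent (T : SiblingTree G Set.univ) (hX : ∀ v ∈ X, T.parent v ∈ X) (hx : x ∈ X)
    (hxr : x ≠ T.root)
    (hmax : ∀ v ∈ X, v ≠ T.root → T.rank (T.parent v) ≤ T.rank (T.parent x)) :
    IsCorner G s 1 X x (T.parent x) where
  left_mem := hx
  right_mem := hX x hx
  ne := (T.adj_parent trivial hxr).ne
  subset := by
    rintro z ⟨⟨p, -, hp⟩, hz⟩
    have hzp : z ≠ T.parent x := by
      rintro rfl
      exact hp p.end_mem_support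
    have hdesc : T.Descends z (T.parent x) := descends_parent.of_walk p hp
    have hzr : z ≠ T.root := by
      rintro rfl
      exact hzp hdesc.eq_root.symm
    have hsibling : T.parent z = T.parent x := by
      by_contra hne
      have := ((descends_iff.1 hdesc).resolve_left hzp).rank_lt hne
      exact this.not_ge (hmax z hz hzr)
    exact mem_ball_one.2 (.inr (hsibling ▸ (T.adj_parent trivial hzr).symm))

theorem dismantlableSet [Finite V] (T : SiblingTree G Set.univ) (hroot : T.root ∈ X)
    (hX : ∀ v ∈ X, T.parent v ∈ X) : DismantlableSet G s 1 X := by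
  induction X using WellFoundedLT.induction with
  | ind X ih =>
    rcases (X \ {T.root}).eq_empty_or_nonempty with hempty | hne
    · rw [(Set.sdiff_eq_empty.1 hempty).antisymm (Set.singleton_subset_iff.2 hroot)]
      exact .singleton _
    obtain ⟨x, ⟨hx, hxr⟩, hmax⟩ :=
      Set.exists_max_image (X \ {T.root}) (T.rank ∘ T.parent) (Set.toFinite _) hne
    have hmax (v : V) (hv : v ∈ X) (hvr : v ≠ T.root) : T.rank (T.parent v) ≤ T.rank (T.parent x) :=
      hmax v ⟨hv, hvr⟩
    refine .delete (T.isCorner_parent hX hx hxr hmax) <|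
      ih _ (Set.sdiff_singleton_ssubset.2 hx) ⟨hroot, Ne.symm hxr⟩ ?_
    rintro v ⟨hv, -⟩
    refine ⟨hX v hv, ?_⟩
    rintro rfl
    have hvr : v ≠ T.root := fun he => hxr (he ▸ T.parent_root)
    exact (hmax v hv hvr).not_gt (T.rank_parent_lt trivial hxr)

end SiblingTree

theorem dismantlableSet_univ_iff_nonempty_siblingTree [Finite V] (hs : 3 ≤ s) :
    DismantlableSet G s 1 Set.univ ↔ Nonempty (SiblingTree G Set.univ) :=
  ⟨fun h => h.nonempty_siblingTree hs,
    fun ⟨T⟩ => T.dismantlableSet trivial fun _ _ => trivial⟩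

/-! ### Blocks -/

theorem forall_of_preconnected_induce {S : Set V} (hS : (G.induce S).Preconnected) {P : V → Prop}
    (hP : ∀ v ∈ S, ∀ w ∈ S, G.Adj v w → P v → P w) (hx : x ∈ S) (hPx : P x) : ∀ z ∈ S, P z := by
  suffices h : ∀ z : S, P z from fun z hz => h ⟨z, hz⟩
  intro z
  have hxz := (SimpleGraph.reachable_iff_reflTransGen _ _).1 (hS ⟨x, hx⟩ z)
  induction hxz with
  | refl => exact hPx
  | @tail v w _ hvw ih => exact hP v v.2 w w.2 hvw ih

theorem Dominates.connected {S : Set V} {a : V} (ha : Dominates G a S) :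
    (G.induce S).Connected :=
  SimpleGraph.Connected.of_isUniversal (v := ⟨a, ha.1⟩) fun w hw =>
    ha.2 w w.2 fun he => hw (Subtype.ext he.symm)

theorem Nonseparable.nonempty {B : Set V} (h : Nonseparable G B) : B.Nonempty :=
  Set.nonempty_coe_sort.1 h.1.nonempty

theorem Nonseparable.preconnected_sdiff {B : Set V} (h : Nonseparable G B) (v : V) :
    (G.induce (B \ {v})).Preconnected := by
  by_cases hv : v ∈ B
  · exact h.2 v hv
  · rw [Set.sdiff_singleton_eq_self hv]
    exact h.1.preconnected

theorem Dominates.nonseparable {S : Set V} {a : V} (ha : Dominates G a S)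
    (h : (G.induce (S \ {a})).Preconnected) : Nonseparable G S := by
  refine ⟨ha.connected, fun v _ => ?_⟩
  rcases eq_or_ne v a with rfl | hva
  · exact h
  · have hdom : Dominates G a (S \ {v}) := ⟨⟨ha.1, hva.symm⟩, fun w hw => ha.2 w hw.1⟩
    exact hdom.connected.preconnected

theorem nonseparable_singleton (G : SimpleGraph V) (v : V) : Nonseparable G {v} := by
  have hdom : Dominates G v {v} := ⟨rfl, fun w hw hwv => absurd hw hwv⟩
  refine hdom.nonseparable ?_
  rw [Set.sdiff_self]
  exact .of_subsingleton

theorem nonseparable_pair {v w : V} (h : G.Adj v w) : Nonseparable G {v, w} := by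
  have hdom : Dominates G v {v, w} := by
    refine ⟨.inl rfl, ?_⟩
    rintro x (rfl | rfl) hx
    exacts [absurd rfl hx, h]
  refine hdom.nonseparable ?_
  rw [Set.pair_sdiff_left h.ne]
  exact .of_subsingleton

theorem Nonseparable.union {B C : Set V} (hB : Nonseparable G B) (hC : Nonseparable G C)
    (h : (B ∩ C).Nontrivial) : Nonseparable G (B ∪ C) := by
  refine ⟨SimpleGraph.induce_union_connected hB.1.preconnected hC.1.preconnected h.nonempty,
    fun v _ => ?_⟩
  rw [Set.union_sdiff_distrib]
  obtain ⟨x, hx, hxv⟩ := h.exists_ne v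
  exact (SimpleGraph.induce_union_connected (hB.preconnected_sdiff v) (hC.preconnected_sdiff v)
    ⟨x, ⟨hx.1, hxv⟩, ⟨hx.2, hxv⟩⟩).preconnected

theorem exists_walk_to_end_of_isPath {a t v : V} {p : G.Walk a z} (hp : p.IsPath)
    (ht : t ∈ p.support) (htv : t ≠ v) :
    ∃ e, (e = a ∨ e = z) ∧ ∃ q : G.Walk t e, q.support ⊆ p.support ∧ v ∉ q.support := by
  obtain ⟨q, r, -, -, rfl⟩ := hp.mem_support_iff_exists_append.1 ht
  by_cases hvq : v ∈ q.support
  · refine ⟨z, .inr rfl, r, fun u hu => ?_, fun hvr => ?_⟩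
    · exact (SimpleGraph.Walk.mem_support_append_iff _ _).2 (.inr hu)
    · exact hp.ne_of_mem_support_of_append htv.symm hvq hvr rfl
  · refine ⟨a, .inl rfl, q.reverse, fun u hu => ?_, by simpa using hvq⟩
    exact (SimpleGraph.Walk.mem_support_append_iff _ _).2 (.inl (by simpa using hu))

theorem Nonseparable.union_support {B : Set V} (hB : Nonseparable G B) {a : V} (ha : a ∈ B)
    (hz : z ∈ B) {p : G.Walk a z} (hp : p.IsPath) :
    Nonseparable G (B ∪ {t | t ∈ p.support}) := by
  refine ⟨SimpleGraph.induce_union_connected hB.1.preconnected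
    p.connected_induce_support.preconnected ⟨a, ha, p.start_mem_support⟩, fun v _ => ?_⟩
  set S := (B ∪ {t | t ∈ p.support}) \ {v}
  have hBS : B \ {v} ⊆ S := Set.sdiff_subset_sdiff_left Set.subset_union_left
  have reachable_B (x : S) :
      ∃ y : ↥(B \ {v}), (G.induce S).Reachable x (Set.inclusion hBS y) := by
    obtain ⟨x, hx | hx, hxv⟩ := x
    · exact ⟨⟨x, hx, hxv⟩, .refl _⟩
    obtain ⟨e, he, q, hqp, hvq⟩ := exists_walk_to_end_of_isPath hp hx hxv
    have heB : e ∈ B := by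
      rcases he with rfl | rfl
      exacts [ha, hz]
    have hqS : ∀ t ∈ q.support, t ∈ S := fun t ht => ⟨.inr (hqp ht), fun htv => hvq (htv ▸ ht)⟩
    exact ⟨⟨e, heB, fun hev => hvq (hev ▸ q.end_mem_support)⟩, ⟨q.induce S hqS⟩⟩
  intro x y
  obtain ⟨x', hx'⟩ := reachable_B x
  obtain ⟨y', hy'⟩ := reachable_B y
  have hxy' := (hB.preconnected_sdiff v x' y').map (SimpleGraph.induceHomOfLE G hBS).toHom
  exact hx'.trans (hxy'.trans hy'.symm)

theorem Nonseparable.exists_block [Finite V] {S : Set V} (h : Nonseparable G S) :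
    ∃ B : Block G, S ⊆ B.1 := by
  obtain ⟨B, hSB, hB⟩ := Set.Finite.exists_le_maximal (Set.toFinite {B | Nonseparable G B}) h
  exact ⟨⟨B, hB⟩, hSB⟩

namespace Block

variable {B C Q R : Block G}

theorem eq_of_nontrivial_inter (h : (B.1 ∩ C.1).Nontrivial) : B = C := by
  have hBC := B.2.1.union C.2.1 h
  refine Subtype.ext (subset_antisymm ?_ ?_)
  · exact Set.subset_union_left.trans (C.2.2 hBC Set.subset_union_right)
  · exact Set.subset_union_right.trans (B.2.2 hBC Set.subset_union_left)

theorem inter_subsingleton (h : B ≠ C) : (B.1 ∩ C.1).Subsingleton :=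
  Set.not_nontrivial_iff.1 fun hBC => h (eq_of_nontrivial_inter hBC)

theorem support_subset (B : Block G) {a : V} (ha : a ∈ B.1) (hz : z ∈ B.1) {p : G.Walk a z}
    (hp : p.IsPath) : {t | t ∈ p.support} ⊆ B.1 :=
  Set.subset_union_right.trans
    (B.2.2 (B.2.1.union_support ha hz hp) Set.subset_union_left)

theorem not_reachable_deleteEdges (C : Block G) (hx : x ∈ C.1) (hy : y ∈ C.1) (hxy : x ≠ y) :
    ¬ (G.deleteEdges C.1.sym2).Reachable x y := by
  intro h
  obtain ⟨p, hp⟩ := h.exists_isPath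
  have hsub := C.support_subset hx hy (hp.mapLe (G.deleteEdges_le C.1.sym2))
  cases p with
  | nil => exact hxy rfl
  | cons hadj q =>
    exact (SimpleGraph.deleteEdges_adj.1 hadj).2 (Set.mk_mem_sym2_iff.2 ⟨hx, hsub (by simp)⟩)

theorem reachable_deleteEdges (h : Q ≠ C) (hx : x ∈ Q.1) (hy : y ∈ Q.1) :
    (G.deleteEdges C.1.sym2).Reachable x y := by
  refine forall_of_preconnected_induce Q.2.1.1.preconnected (fun v hv w hw hvw hxv => ?_) hx
    (.refl x) y hy
  refine hxv.trans (SimpleGraph.deleteEdges_adj.2 ⟨hvw, fun hC => ?_⟩).reachable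
  obtain ⟨hvC, hwC⟩ := Set.mk_mem_sym2_iff.1 hC
  exact hvw.ne (inter_subsingleton h ⟨hv, hvC⟩ ⟨hw, hwC⟩)

theorem reachable_blockGraph (h : (B.1 ∩ C.1).Nonempty) : (blockGraph G).Reachable B C := by
  rcases eq_or_ne B C with rfl | hBC
  exacts [.refl B, SimpleGraph.Adj.reachable ⟨hBC, h⟩]

theorem reachable_blockGraph_of_walk [Finite V] (p : G.Walk x y) (hx : x ∈ B.1) (hy : y ∈ C.1) :
    (blockGraph G).Reachable B C := by
  induction p generalizing B with
  | nil => exact reachable_blockGraph ⟨_, hx, hy⟩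
  | cons hadj _ ih =>
    obtain ⟨D, hD⟩ := (nonseparable_pair hadj).exists_block
    exact (reachable_blockGraph ⟨_, hx, hD (.inl rfl)⟩).trans (ih (hD (.inr rfl)) hy)

end Block

theorem blockGraph_connected [Finite V] (hG : G.Connected) : (blockGraph G).Connected := by
  obtain ⟨v⟩ := hG.nonempty
  have : Nonempty (Block G) := (nonseparable_singleton G v).exists_block.nonempty
  refine ⟨fun B C => ?_⟩
  obtain ⟨x, hx⟩ := B.2.1.nonempty
  obtain ⟨y, hy⟩ := C.2.1.nonempty
  obtain ⟨p⟩ := hG.preconnected x y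
  exact Block.reachable_blockGraph_of_walk p hx hy

/-! ### From sibling trees to big brother graphs -/

namespace SiblingTree

variable {T : SiblingTree G Set.univ} {a c v w : V} {B P Q R : Block G}

theorem dominates_of_parent_eq (T : SiblingTree G Set.univ) (ha : a ∈ X)
    (h : ∀ v ∈ X, v = a ∨ T.parent v = a) : Dominates G a X := by
  refine ⟨ha, fun v hv hva => ?_⟩
  obtain rfl := (h v hv).resolve_left hva
  refine (T.adj_parent trivial ?_).symm
  rintro rfl
  exact hva T.parent_root.symm

theorem descends_parent_of_nonseparable (T : SiblingTree G Set.univ) (hX : Nonseparable G X)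
    (hw : w ∈ X) (hpw : T.parent w ≠ w) (hz : z ∈ X) : T.Descends z (T.parent w) := by
  by_cases hzp : z = T.parent w
  · exact descends_iff.2 (.inl hzp)
  · exact forall_of_preconnected_induce (P := (T.Descends · (T.parent w)))
      (hX.preconnected_sdiff (T.parent w))
      (fun v hv _ _ hvv' h => h.of_adj hv.2 hvv') ⟨hw, hpw.symm⟩ descends_parent z ⟨hz, hzp⟩

theorem parent_eq_of_preconnected (T : SiblingTree G Set.univ) (hX : (G.induce X).Preconnected)
    (h : ∀ v ∈ X, T.parent v ∈ X → T.parent v = v) (hv : v ∈ X) (hw : w ∈ X) :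
    T.parent w = T.parent v := by
  refine forall_of_preconnected_induce hX (P := (T.parent · = T.parent v))
    (fun p hp q hq hpq hpv => ?_) hv rfl w hw
  rcases T.edge trivial trivial hpq with rfl | rfl | he
  · exact absurd (h q hq hp) hpq.ne
  · exact absurd (h p hp hq) hpq.ne'
  · exact he.symm.trans hpv

theorem exists_forall_parent_eq (T : SiblingTree G Set.univ) (hX : Nonseparable G X) :
    ∃ a, ∀ v ∈ X, v = a ∨ T.parent v = a := by
  by_cases hpar : ∃ w ∈ X, T.parent w ∈ X ∧ T.parent w ≠ w
  · obtain ⟨w, hw, hpw, hne⟩ := hpar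
    refine ⟨T.parent w, fun v hv => or_iff_not_imp_left.2 fun hvw => ?_⟩
    refine T.parent_eq_of_preconnected (hX.preconnected_sdiff (T.parent w)) (fun u hu hpu => ?_)
      ⟨hw, hne.symm⟩ ⟨hv, hvw⟩
    by_contra hpu_ne
    exact hpu.2 <| (T.descends_parent_of_nonseparable hX hw hne hpu.1).antisymm
      (T.descends_parent_of_nonseparable hX hu.1 hpu_ne hpw)
  · push Not at hpar
    obtain ⟨w, hw⟩ := hX.nonempty
    exact ⟨T.parent w, fun v hv => .inr (T.parent_eq_of_preconnected hX.1.preconnected hpar hw hv)⟩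

theorem exists_top (T : SiblingTree G Set.univ) (B : Block G) :
    ∃ a ∈ B.1, ∀ v ∈ B.1, v = a ∨ T.parent v = a := by
  obtain ⟨a, ha⟩ := T.exists_forall_parent_eq B.2.1
  refine ⟨a, ?_, ha⟩
  by_contra haB
  have hdom : Dominates G a (insert a B.1) :=
    T.dominates_of_parent_eq (Set.mem_insert a _) (Set.forall_mem_insert.2 ⟨.inl rfl, ha⟩)
  have hns : Nonseparable G (insert a B.1) := by
    refine hdom.nonseparable ?_
    rw [Set.insert_sdiff_self_of_notMem haB]
    exact B.2.1.1.preconnected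
  exact haB (B.2.2 hns (Set.subset_insert _ _) (Set.mem_insert _ _))

/-- The vertex of the block `B` that is the parent of all other vertices of `B`. -/
noncomputable def top (T : SiblingTree G Set.univ) (B : Block G) : V := (T.exists_top B).choose

theorem top_mem : T.top B ∈ B.1 := (T.exists_top B).choose_spec.1

theorem eq_top_or_parent_eq_top (hv : v ∈ B.1) : v = T.top B ∨ T.parent v = T.top B :=
  (T.exists_top B).choose_spec.2 v hv

theorem dominates_top : Dominates G (T.top B) B.1 :=
  T.dominates_of_parent_eq top_mem fun _ => eq_top_or_parent_eq_top

theorem top_eq_root (hR : T.root ∈ R.1) : T.top R = T.root :=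
  (eq_top_or_parent_eq_top hR).elim Eq.symm fun h => h.symm.trans T.parent_root

theorem Descends.reachable (h : T.Descends v a) : G.Reachable v a := by
  obtain ⟨n, rfl⟩ := h
  induction n generalizing v with
  | zero => rfl
  | succ n ih =>
    refine SimpleGraph.Reachable.trans ?_ ih
    by_cases hv : v = T.root
    · rw [hv, T.parent_root]
    · exact (T.adj_parent trivial hv).reachable

theorem connected (T : SiblingTree G Set.univ) : G.Connected :=
  (SimpleGraph.connected_iff_exists_forall_reachable G).2
    ⟨T.root, fun v => (T.descends_root v).reachable.symm⟩

theorem eq_of_adj_of_descends_top (hc : c ∈ B.1) (hpc : T.parent c ∈ B.1) (hne : T.parent c ≠ c)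
    (hadj : (blockGraph G).Adj Q P) (hQ : ¬ T.Descends (T.top Q) c)
    (hP : T.Descends (T.top P) c) : Q = B := by
  obtain ⟨-, w, hwQ, hwP⟩ := hadj
  have hw : T.Descends w c := by
    rcases eq_top_or_parent_eq_top (T := T) hwP with rfl | h
    exacts [hP, descends_iff.2 (.inr (h ▸ hP))]
  have hpw : T.parent w = T.top Q := by
    refine (eq_top_or_parent_eq_top hwQ).resolve_left ?_
    rintro rfl
    exact hQ hw
  obtain rfl : w = c := (descends_iff.1 hw).resolve_right (hpw ▸ hQ)
  exact Block.eq_of_nontrivial_inter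
    ⟨w, ⟨hwQ, hc⟩, T.parent w, ⟨hpw ▸ top_mem, hpc⟩, hne.symm⟩

theorem mem_support_of_descends_top (hc : c ∈ B.1) (hpc : T.parent c ∈ B.1)
    (hne : T.parent c ≠ c) (p : (blockGraph G).Walk Q P) (hQ : ¬ T.Descends (T.top Q) c)
    (hP : T.Descends (T.top P) c) : B ∈ p.support := by
  induction p with
  | nil => exact absurd hP hQ
  | @cons Q Q' P hadj q ih =>
    by_cases hQ' : T.Descends (T.top Q') c
    · obtain rfl := eq_of_adj_of_descends_top hc hpc hne hadj hQ hQ'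
      exact SimpleGraph.Walk.start_mem_support _
    · exact List.mem_cons_of_mem _ (ih hQ' hP)

theorem eq_top_of_isFather [Finite V] (hR : T.root ∈ R.1) (hPB : IsFather G R P B) (hcP : c ∈ P.1)
    (hcB : c ∈ B.1) : c = T.top B := by
  classical
  obtain ⟨⟨hne, -⟩, hdist⟩ := hPB
  by_contra hc
  have hpc : T.parent c = T.top B := (eq_top_or_parent_eq_top hcB).resolve_left hc
  have htopP : c = T.top P := by
    refine (eq_top_or_parent_eq_top hcP).resolve_right fun h => hc ?_
    have hBP : T.top B ∈ P.1 := hpc ▸ h ▸ top_mem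
    exact Block.inter_subsingleton hne ⟨hcP, hcB⟩ ⟨hBP, top_mem⟩
  have hroot : ¬ T.Descends (T.top R) c := by
    rw [top_eq_root hR]
    intro h
    rw [h.eq_root, T.parent_root, ← h.eq_root] at hpc
    exact hc hpc
  -- a geodesic from `R` to `P` would pass through `B`, which is farther away than `P`
  obtain ⟨p, hp⟩ := (blockGraph_connected T.connected).exists_walk_length_eq_dist R P
  have hmem : B ∈ p.support := mem_support_of_descends_top hcB (hpc ▸ top_mem)
    (hpc ▸ Ne.symm hc) p hroot (htopP ▸ descends_self)
  have h₁ := SimpleGraph.dist_le (p.takeUntil B hmem)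
  have h₂ := p.length_takeUntil_le_length hmem
  omega

theorem isBigBrother [Finite V] (T : SiblingTree G Set.univ) : IsBigBrother G := by
  obtain ⟨R, hR⟩ := (nonseparable_singleton G T.root).exists_block
  refine ⟨blockGraph_connected T.connected, fun B => ⟨T.top B, dominates_top⟩, R,
    fun P B hPB => ?_⟩
  obtain ⟨c, hcP, hcB⟩ := hPB.1.2
  obtain rfl := eq_top_of_isFather (hR rfl) hPB hcP hcB
  exact ⟨_, (Block.inter_subsingleton hPB.1.1).eq_singleton_of_mem ⟨hcP, hcB⟩, dominates_top⟩

end SiblingTree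

/-! ### From big brother graphs to sibling trees -/

theorem exists_adj_dist_eq_add_one {W : Type*} {H : SimpleGraph W} (hH : H.Connected) {r b : W}
    (hb : b ≠ r) : ∃ p, H.Adj p b ∧ H.dist r b = H.dist r p + 1 := by
  obtain ⟨q, hq⟩ := hH.exists_walk_length_eq_dist b r
  cases q with
  | nil => exact absurd rfl hb
  | @cons _ p _ hadj q =>
    refine ⟨p, hadj.symm, ?_⟩
    have hle := SimpleGraph.dist_le q
    have htri := hH.dist_triangle (u := b) (v := p) (w := r)
    rw [SimpleGraph.dist_eq_one_iff_adj.2 hadj] at htri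
    rw [SimpleGraph.Walk.length_cons] at hq
    rw [H.dist_comm (u := r), H.dist_comm (u := r)]
    omega

namespace Block

variable {R C Q Q' : Block G} {r v : V}

theorem exists_isFather (hG : (blockGraph G).Connected) (hC : C ≠ R) : ∃ P, IsFather G R P C :=
  exists_adj_dist_eq_add_one hG hC

theorem reachable_deleteEdges_of_dist_le (hG : (blockGraph G).Connected) (hr : r ∈ R.1)
    (hQC : Q ≠ C) (hQ : (blockGraph G).dist R Q ≤ (blockGraph G).dist R C) (hx : x ∈ Q.1) :
    (G.deleteEdges C.1.sym2).Reachable r x := by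
  induction hn : (blockGraph G).dist R Q generalizing Q x with
  | zero =>
    obtain rfl := hG.dist_eq_zero_iff.1 hn
    exact reachable_deleteEdges hQC hr hx
  | succ n ih =>
    have hQR : Q ≠ R := by
      rintro rfl
      simp at hn
    obtain ⟨P, ⟨-, y, hyP, hyQ⟩, hdist⟩ := exists_isFather hG hQR
    have hPC : P ≠ C := by
      rintro rfl
      omega
    exact (ih hPC (by omega) hyP (by omega)).trans (reachable_deleteEdges hQC hyQ hx)

theorem eq_of_mem_of_dist_le (hG : (blockGraph G).Connected) (hx : x ∈ C.1) (hy : y ∈ C.1)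
    (hQC : Q ≠ C) (hQ : (blockGraph G).dist R Q ≤ (blockGraph G).dist R C) (hxQ : x ∈ Q.1)
    (hQC' : Q' ≠ C) (hQ' : (blockGraph G).dist R Q' ≤ (blockGraph G).dist R C) (hyQ' : y ∈ Q'.1) :
    x = y := by
  obtain ⟨r, hr⟩ := R.2.1.nonempty
  by_contra hxy
  exact C.not_reachable_deleteEdges hx hy hxy
    ((reachable_deleteEdges_of_dist_le hG hr hQC hQ hxQ).symm.trans
      (reachable_deleteEdges_of_dist_le hG hr hQC' hQ' hyQ'))

theorem exists_closest [Finite V] (R : Block G) (v : V) :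
    ∃ B : Block G, v ∈ B.1 ∧
      ∀ C : Block G, v ∈ C.1 → (blockGraph G).dist R B ≤ (blockGraph G).dist R C := by
  obtain ⟨B, hB⟩ := (nonseparable_singleton G v).exists_block
  exact Set.exists_min_image {B : Block G | v ∈ B.1} ((blockGraph G).dist R) (Set.toFinite _)
    ⟨B, hB rfl⟩

/-- A block closest to `R` among the blocks that contain `v`. -/
noncomputable def home [Finite V] (R : Block G) (v : V) : Block G := (exists_closest R v).choose

theorem mem_home [Finite V] : v ∈ (home R v).1 := (exists_closest R v).choose_spec.1

theorem dist_home_le [Finite V] (hv : v ∈ C.1) :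
    (blockGraph G).dist R (home R v) ≤ (blockGraph G).dist R C :=
  (exists_closest R v).choose_spec.2 C hv

theorem home_eq_root [Finite V] (hG : (blockGraph G).Connected) (hv : v ∈ R.1) :
    home R v = R := by
  have hle := dist_home_le (R := R) hv
  rw [SimpleGraph.dist_self, Nat.le_zero] at hle
  exact (hG.dist_eq_zero_iff.1 hle).symm

end Block

/-- `apex C` is a dominating vertex of the block `C` that also belongs to a father of `C` when
`C` is not the root block `R`. -/
structure IsApex (G : SimpleGraph V) (R : Block G) (apex : Block G → V) : Prop where
  dominates : ∀ C, Dominates G (apex C) C.1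
  exists_father : ∀ C ≠ R, ∃ P, IsFather G R P C ∧ apex C ∈ P.1

theorem IsBigBrother.exists_isApex (hG : IsBigBrother G) : ∃ R apex, IsApex G R apex := by
  obtain ⟨hconn, hdom, R, hR⟩ := hG
  have (C : Block G) : ∃ a, Dominates G a C.1 ∧ (C ≠ R → ∃ P, IsFather G R P C ∧ a ∈ P.1) := by
    rcases eq_or_ne C R with rfl | hC
    · obtain ⟨a, ha⟩ := hdom C
      exact ⟨a, ha, fun h => absurd rfl h⟩
    · obtain ⟨P, hP⟩ := Block.exists_isFather hconn hC
      obtain ⟨a, haP, ha⟩ := hR P C hP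
      have haPC : a ∈ P.1 ∩ C.1 := haP ▸ rfl
      exact ⟨a, ha, fun _ => ⟨P, hP, haPC.1⟩⟩
  choose apex hapex hfather using this
  exact ⟨R, apex, hapex, hfather⟩

namespace IsApex

variable [Finite V] {R C : Block G} {apex : Block G → V} {v w : V}

theorem home_eq (h : IsApex G R apex) (hG : (blockGraph G).Connected) (hv : v ∈ C.1)
    (hva : v ≠ apex C) : Block.home R v = C := by
  rcases eq_or_ne C R with rfl | hC
  · exact Block.home_eq_root hG hv
  by_contra hne
  obtain ⟨P, ⟨⟨hPC, -⟩, hdist⟩, haP⟩ := h.exists_father C hC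
  exact hva (Block.eq_of_mem_of_dist_le hG hv (h.dominates C).1 hne (Block.dist_home_le hv)
    Block.mem_home hPC (by omega) haP)

theorem dist_home_apex_lt (h : IsApex G R apex) (hC : C ≠ R) :
    (blockGraph G).dist R (Block.home R (apex C)) < (blockGraph G).dist R C := by
  obtain ⟨P, ⟨-, hdist⟩, haP⟩ := h.exists_father C hC
  exact (Block.dist_home_le haP).trans_lt (by omega)

theorem ne_apex_home (h : IsApex G R apex) (hv : v ≠ apex R) : v ≠ apex (Block.home R v) := by
  intro hva
  have hR : Block.home R v ≠ R := fun hR => hv (hR ▸ hva)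
  have := h.dist_home_apex_lt hR
  rw [← hva] at this
  exact this.false

theorem edge (h : IsApex G R apex) (hG : (blockGraph G).Connected) (hvw : G.Adj v w) :
    v = apex (Block.home R w) ∨ w = apex (Block.home R v) ∨
      apex (Block.home R v) = apex (Block.home R w) := by
  obtain ⟨C, hC⟩ := (nonseparable_pair hvw).exists_block
  have hv : v ∈ C.1 := hC (.inl rfl)
  have hw : w ∈ C.1 := hC (.inr rfl)
  by_cases hva : v = apex C
  · exact .inl (by rw [h.home_eq hG hw (hva ▸ hvw.ne'), hva])
  by_cases hwa : w = apex C
  · exact .inr (.inl (by rw [h.home_eq hG hv hva, hwa]))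
  · exact .inr (.inr (by rw [h.home_eq hG hv hva, h.home_eq hG hw hwa]))

open Classical in
/-- The tree in which the parent of a vertex is the apex of its home block. -/
noncomputable def siblingTree (h : IsApex G R apex) (hG : (blockGraph G).Connected) :
    SiblingTree G Set.univ where
  root := apex R
  parent v := apex (Block.home R v)
  rank v := if v = apex R then 0 else (blockGraph G).dist R (Block.home R v) + 1
  root_mem := trivial
  parent_root := by rw [Block.home_eq_root hG (h.dominates R).1]
  parent_mem _ := trivial
  adj_parent _ hv := ((h.dominates _).2 _ Block.mem_home (h.ne_apex_home hv)).symm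
  rank_parent_lt {v} _ hv := by
    rw [if_neg hv]
    split_ifs with hR
    · exact Nat.succ_pos _
    · exact Nat.succ_lt_succ (h.dist_home_apex_lt fun he => hR (congrArg apex he))
  edge _ _ hvw := h.edge hG hvw

end IsApex

theorem isBigBrother_iff_nonempty_siblingTree [Finite V] :
    IsBigBrother G ↔ Nonempty (SiblingTree G Set.univ) := by
  refine ⟨fun hG => ?_, fun ⟨T⟩ => T.isBigBrother⟩
  obtain ⟨R, apex, h⟩ := hG.exists_isApex
  exact ⟨h.siblingTree hG.1⟩

theorem dismantlable_iff_isBigBrother [Finite V] [Nonempty V] (hs : 3 ≤ s) :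
    Dismantlable G s 1 ↔ IsBigBrother G := by
  rw [dismantlable_iff, dismantlableSet_univ_iff_nonempty_siblingTree hs,
    isBigBrother_iff_nonempty_siblingTree]

theorem cwfr_iff_isBigBrother [Finite V] [Nonempty V] (hs : 3 ≤ s) :
    CWFR G s ↔ IsBigBrother G := by
  rw [CWFR, cwfr'_iff_dismantlable (le_trans (by norm_num) hs), dismantlable_iff_isBigBrother hs]

end FastRobber

theorem mainTheorem3 {V : Type*} [Finite V] [Nonempty V] (G : SimpleGraph V) :
    List.TFAE [
      FastRobber.CWFR G 3,
      FastRobber.Dismantlable G 3 1,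
      FastRobber.CWFR G ⊤,
      FastRobber.Dismantlable G ⊤ 1,
      FastRobber.IsBigBrother G] ∧
    ∀ s t : ℕ∞, 3 ≤ s → 3 ≤ t → (FastRobber.CWFR G s ↔ FastRobber.CWFR G t) := by
  have cwfr_iff (s : ℕ∞) (hs : 3 ≤ s) := FastRobber.cwfr_iff_isBigBrother (G := G) hs
  have dismantlable_iff (s : ℕ∞) (hs : 3 ≤ s) :=
    FastRobber.dismantlable_iff_isBigBrother (G := G) hs
  refine ⟨?_, fun s t hs ht => (cwfr_iff s hs).trans (cwfr_iff t ht).symm⟩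
  tfae_have 1 ↔ 5 := cwfr_iff 3 le_rfl
  tfae_have 2 ↔ 5 := dismantlable_iff 3 le_rfl
  tfae_have 3 ↔ 5 := cwfr_iff ⊤ le_top
  tfae_have 4 ↔ 5 := dismantlable_iff ⊤ le_top
  tfae_finish
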